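/- Let $X$ be a connected Alexandroff space (arbitrary intersections of open sets are open). Write $U_x$ for the smallest open set containing $x$, and regard $X$ as a preordered set, hence as a thin category, by $x\le y \iff U_x\subseteq U_y$. Let $x_0\in X$, let $G$ be a group, regarded as a category with a unique object $*$, and let $\mathcal{F}\colon X\to G$ be a functor. Let $\widetilde X=\mathcal{F}\downarrow *$ be the comma category; it is the preordered set $X\times G$ with $(x,g)\le(x',g')$ if and only if $x\le x'$ and $g=g'\,\mathcal{F}(x\le x')$, and it is given the topology whose open sets are the lower sets. Let $p\colon\widetilde X\to X$ be the canonical projection and let $\tilde x_0\in p^{-1}(x_0)$. Let $\mathcal{L}X$ be the localization of the category $X$ at all its arrows, and identify $\mathrm{Aut}_{\mathcal{L}X}(x_0)$ with $\pi_1(X,x_0)$ by the canonical isomorphism that sends an arrow $x\le y$ to the class of the path that is $x$ for $t<1$ and $y$ for $t=1$. Let $\mathcal{F}_*\colon\pi_1(X,x_0)\to G$ be the homomorphism that $\mathcal{F}$ induces on $\mathrm{Aut}_{\mathcal{L}X}(x_0)$. (Products are composites of arrows: in $\pi_1(X,x_0)$, $[\beta][\alpha]$ is the class of $\alpha$ followed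 by $\beta$.) Then $p$ is a regular covering map (it is a surjective covering map, and its deck transformations act transitively on every fibre; $\widetilde X$ need not be connected), it corresponds to the kernel of $\mathcal{F}_*$, that is, $$p_*\bigl(\pi_1(\widetilde X,\tilde x_0)\bigr)=\ker\mathcal{F}_*,$$ and $\pi_0(\widetilde X,\tilde x_0)\cong\operatorname{coker}\mathcal{F}_*$ as pointed sets, where $\operatorname{coker}\mathcal{F}_*$ is the set $G/\operatorname{im}\mathcal{F}_*$ of left cosets, pointed by the class of $1$. More precisely, if $\tilde x_0=(x_0,g_0)$, there is a bijection that sends the path component of $(x_0,g_0g)$ to $g\operatorname{im}\mathcal{F}_*$ for every $g\in G$. In particular, let $T$ be a maximal tree of $X$, that is, a wide subcategory of $X$ such that there is exactly one arrow in $\mathcal{L}T$ between any two objects, and let $\alpha\colon\pi_1(X,x_0)\to G$ be a group homomorphism. Let $\mathcal{F}_{T,\alpha}\colon X\to G$ be the functor that sends $x\le y$ to $\alpha(b\circ(x\le y)\circ a)$, where $a$ and $b$ are the images in $\mathcal{L}X$ of the unique arrows $x_0\to x$ and $y\to x_0$ of $\mathcal{L}T$. If $\mathcal{F}=\mathcal{F}_{T,\alpha}$,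 then $p$ is a regular covering map with $$p_*\bigl(\pi_1(\widetilde X,\tilde x_0)\bigr)=\ker\alpha ,$$ and $\pi_0(\widetilde X,\tilde x_0)\cong G/\operatorname{im}\alpha=\operatorname{coker}\alpha$ as pointed sets, by a bijection that sends the path component of $(x_0,g_0g)$ to $g\operatorname{im}\alpha$ for every $g\in G$, where $\tilde x_0=(x_0,g_0)$. -/

import Mathlib

open CategoryTheory Topology

universe u v w

noncomputable section

namespace AlexandroffCovering

/-! ### Alexandroff spaces as preordered sets -/

/-- The minimal open set `U_x`: the intersection of all open sets containing `x`. -/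
def minOpen {X : Type u} [TopologicalSpace X] (x : X) : Set X :=
  ⋂₀ {U : Set X | IsOpen U ∧ x ∈ U}

/-- The points of a space `X`, regarded as a preordered set (and so as a thin category)
with the specialization preorder `x ≤ y ↔ U_x ⊆ U_y`. -/
structure SpecPt (X : Type u) where
  /-- the underlying point of the space -/
  pt : X

instance (X : Type u) [TopologicalSpace X] : Preorder (SpecPt X) where
  le x y := minOpen x.pt ⊆ minOpen y.pt
  le_refl _ := subset_rfl
  le_trans _ _ _ h₁ h₂ := h₁.trans h₂

section

variable {X : Type u} [TopologicalSpace X]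

lemma mem_minOpen_iff {x y : X} : x ∈ minOpen y ↔ x ⤳ y := by
  rw [specializes_iff_forall_open]
  simp [minOpen]

lemma specPt_le_iff {x y : SpecPt X} : x ≤ y ↔ x.pt ⤳ y.pt := by
  constructor
  · intro h
    exact mem_minOpen_iff.1 (h (mem_minOpen_iff.2 specializes_rfl))
  · intro h z hz
    exact mem_minOpen_iff.2 ((mem_minOpen_iff.1 hz).trans h)

/-! ### The comparison of the localization with the fundamental groupoid -/

/-- The path `η(x ≤ y)`, equal to `x` for `t < 1` and to `y` for `t = 1`. -/
def eta {x y : SpecPt X} (h : x ≤ y) : Path x.pt y.pt where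
  toFun t := if t < 1 then x.pt else y.pt
  continuous_toFun := by
    rw [continuous_def]
    intro V hV
    have hs : y.pt ∈ V → x.pt ∈ V := (specPt_le_iff.1 h).mem_open hV
    by_cases hy : y.pt ∈ V
    · convert isOpen_univ
      ext t
      by_cases ht : t < 1 <;> simp [ht, hy, hs hy]
    · by_cases hx : x.pt ∈ V
      · convert (isOpen_Iio : IsOpen (Set.Iio (1 : unitInterval)))
        ext t
        by_cases ht : t < 1 <;> simp [ht, hy, hx]
      · convert isOpen_empty
        ext t
        by_cases ht : t < 1 <;> simp [ht, hy, hx]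
  source' := by simp
  target' := by simp

/-- The space of all points below a given point is contractible. -/
lemma contractible_below (z : X) : ContractibleSpace {y : X // y ⤳ z} := by
  rw [contractible_iff_id_nullhomotopic]
  refine ⟨⟨z, specializes_rfl⟩, ⟨⟨⟨fun q => if q.1 < 1 then q.2 else ⟨z, specializes_rfl⟩, ?_⟩,
    fun y => by simp, fun y => by simp⟩⟩⟩
  rw [continuous_def]
  intro V hV
  obtain ⟨W, hW, rfl⟩ := isOpen_induced_iff.1 hV
  by_cases hz : z ∈ W
  · convert isOpen_univ
    ext q
    have : (q.2 : X) ∈ W := q.2.2.mem_open hW hz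
    by_cases ht : q.1 < 1 <;> simp [ht, hz, this]
  · convert (isOpen_Iio : IsOpen (Set.Iio (1 : unitInterval))).prod hV
    ext q
    by_cases ht : q.1 < 1 <;> simp [ht, hz]

lemma homotopic_of_below {x y : X} (z : X) (γ δ : Path x y) (hγ : ∀ t, γ t ⤳ z)
    (hδ : ∀ t, δ t ⤳ z) : γ.Homotopic δ := by
  have := contractible_below z
  let x' : {y : X // y ⤳ z} := ⟨x, by simpa using hγ 0⟩
  let y' : {y : X // y ⤳ z} := ⟨y, by simpa using hγ 1⟩
  let γ' : Path x' y' := ⟨⟨fun t => ⟨γ t, hγ t⟩, by fun_prop⟩, by simp [x'], by simp [y']⟩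
  let δ' : Path x' y' := ⟨⟨fun t => ⟨δ t, hδ t⟩, by fun_prop⟩, by simp [x'], by simp [y']⟩
  exact (SimplyConnectedSpace.paths_homotopic γ' δ').map ⟨Subtype.val, continuous_subtype_val⟩

lemma eta_below {x y : SpecPt X} (h : x ≤ y) (z : X) (hy : y.pt ⤳ z) (t : unitInterval) :
    eta h t ⤳ z := by
  change (if t < 1 then x.pt else y.pt) ⤳ z
  split_ifs
  · exact (specPt_le_iff.1 h).trans hy
  · exact hy

lemma trans_below {x y w z : X} (γ : Path x y) (δ : Path y w) (hγ : ∀ t, γ t ⤳ z)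
    (hδ : ∀ t, δ t ⤳ z) (t : unitInterval) : (γ.trans δ) t ⤳ z := by
  rw [Path.trans_apply]
  split_ifs
  · exact hγ _
  · exact hδ _

variable (X) in
/-- The functor from the preordered set `X` to the fundamental groupoid of the space `X` that
sends the arrow `x ≤ y` to the class of the path `η(x ≤ y)`. -/
def etaFunctor : SpecPt X ⥤ FundamentalGroupoid X where
  obj x := ⟨x.pt⟩
  map f := Path.Homotopic.Quotient.mk (eta (leOfHom f))
  map_id x := Quotient.sound (homotopic_of_below x.pt _ _
    (eta_below _ _ specializes_rfl) (fun _ => specializes_rfl))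
  map_comp {_ _ z} _ g := Quotient.sound (homotopic_of_below z.pt _ _
    (eta_below _ _ specializes_rfl)
    (trans_below _ _ (eta_below _ _ (specPt_le_iff.1 (leOfHom g)))
      (eta_below _ _ specializes_rfl)))

variable (X) in
/-- The functor induced by `etaFunctor` on the localization of the preordered set `X` at all
of its arrows. -/
def locToPi : FreeGroupoid (SpecPt X) ⥤ FundamentalGroupoid X :=
  FreeGroupoid.lift (etaFunctor X)

/-- Auxiliary: the arrows of the localization that start at `x₀`, ordered by composition with
arrows of `X`. -/
structure PathSpace (x₀ : X) where
  /-- the end point -/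
  tgt : SpecPt X
  /-- the arrow -/
  hom : FreeGroupoid.mk (SpecPt.mk x₀) ⟶ FreeGroupoid.mk tgt

instance (x₀ : X) : Preorder (PathSpace x₀) where
  le a b := ∃ f : a.tgt ⟶ b.tgt, a.hom ≫ FreeGroupoid.homMk f = b.hom
  le_refl a := ⟨𝟙 _, by simp⟩
  le_trans a b c := by
    rintro ⟨f, hf⟩ ⟨g, hg⟩
    exact ⟨f ≫ g, by rw [← hg, ← hf]; simp⟩

instance (x₀ : X) : TopologicalSpace (PathSpace x₀) := Topology.lowerSet _

lemma pathSpace_isOpen {x₀ : X} {s : Set (PathSpace x₀)} : IsOpen s ↔ IsLowerSet s := Iff.rfl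

lemma isOpen_iff_below [AlexandrovDiscrete X] {s : Set X} :
    IsOpen s ↔ ∀ x y : SpecPt X, x ≤ y → y.pt ∈ s → x.pt ∈ s := by
  rw [isOpen_iff_forall_specializes]
  exact ⟨fun h x y hxy => h _ _ (specPt_le_iff.1 hxy),
    fun h x y hxy => h ⟨x⟩ ⟨y⟩ (specPt_le_iff.2 hxy)⟩

lemma pathSpace_continuous [AlexandrovDiscrete X] (x₀ : X) :
    Continuous (fun a : PathSpace x₀ => a.tgt.pt) := by
  rw [continuous_def]
  intro s hs
  rw [pathSpace_isOpen]
  rintro a b ⟨f, -⟩ ha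
  exact isOpen_iff_below.1 hs _ _ (leOfHom f) ha

lemma pathSpace_covering [AlexandrovDiscrete X] (x₀ : X) :
    IsCoveringMap (fun a : PathSpace x₀ => a.tgt.pt) := by
  intro x
  let M := FreeGroupoid.mk (SpecPt.mk x₀) ⟶ FreeGroupoid.mk (SpecPt.mk x)
  let _ : TopologicalSpace M := ⊥
  have : DiscreteTopology M := ⟨rfl⟩
  refine IsEvenlyCovered.to_isEvenlyCovered_preimage (I := M) ⟨inferInstance, minOpen x,
    mem_minOpen_iff.2 specializes_rfl, ?_, ?_, ?_⟩
  · exact isOpen_sInter fun s hs => hs.1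
  · exact (isOpen_sInter fun s hs => hs.1).preimage (pathSpace_continuous x₀)
  · have key : ∀ y : SpecPt X, y.pt ∈ minOpen x → y ≤ SpecPt.mk x := fun y hy =>
      specPt_le_iff.2 (mem_minOpen_iff.1 hy)
    refine ⟨⟨⟨fun a => (⟨a.1.tgt.pt, a.2⟩, a.1.hom ≫ FreeGroupoid.homMk (homOfLE (key _ a.2))),
      fun b => ⟨⟨⟨b.1.1⟩, b.2 ≫ Groupoid.inv (FreeGroupoid.homMk (homOfLE (key ⟨b.1.1⟩ b.1.2)))⟩,
        b.1.2⟩, ?_, ?_⟩, ?_, ?_⟩, ?_⟩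
    · rintro ⟨⟨⟨y⟩, m⟩, hy⟩
      simp
    · rintro ⟨⟨y, hy⟩, m⟩
      simp
    · refine Continuous.prodMk
        (((pathSpace_continuous x₀).comp continuous_subtype_val).subtype_mk _) ?_
      rw [continuous_def]
      intro s _
      refine ⟨{b | ∃ h : b.tgt.pt ∈ minOpen x,
        b.hom ≫ FreeGroupoid.homMk (homOfLE (key _ h)) ∈ s}, ?_, ?_⟩
      · rw [pathSpace_isOpen]
        rintro a b ⟨f, hf⟩ ⟨h, hs⟩
        refine ⟨mem_minOpen_iff.2 ((specPt_le_iff.1 (leOfHom f)).trans (mem_minOpen_iff.1 h)), ?_⟩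
        rw [← hf, Category.assoc, ← Functor.map_comp] at hs
        exact hs
      · ext ⟨a, ha⟩
        simp only [Set.mem_preimage, Set.mem_ofPred_eq]
        exact ⟨fun ⟨_, h⟩ => h, fun h => ⟨ha, h⟩⟩
    · refine Continuous.subtype_mk ?_ _
      rw [continuous_prod_of_discrete_right]
      intro m
      rw [continuous_def]
      intro s hs
      rw [pathSpace_isOpen] at hs
      refine ⟨{y | ∃ h : y ∈ minOpen x, PathSpace.mk (x₀ := x₀) ⟨y⟩
        (m ≫ Groupoid.inv (FreeGroupoid.homMk (homOfLE (key ⟨y⟩ h)))) ∈ s}, ?_, ?_⟩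
      · rw [isOpen_iff_below]
        rintro ⟨a⟩ ⟨b⟩ hab ⟨h, hb⟩
        have ha : a ∈ minOpen x := mem_minOpen_iff.2
          ((specPt_le_iff.1 hab).trans (mem_minOpen_iff.1 h))
        refine ⟨ha, hs ⟨homOfLE hab, ?_⟩ hb⟩
        have e : FreeGroupoid.homMk (homOfLE (key ⟨a⟩ ha)) =
            FreeGroupoid.homMk (homOfLE hab) ≫ FreeGroupoid.homMk (homOfLE (key ⟨b⟩ h)) :=
          (FreeGroupoid.of (SpecPt X)).map_comp (homOfLE hab) (homOfLE (key ⟨b⟩ h))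
        simp only [e, Groupoid.inv_eq_inv, IsIso.inv_comp, Category.assoc, IsIso.inv_hom_id,
          Category.comp_id]
      · ext ⟨a, ha⟩
        simp only [Set.mem_preimage, Set.mem_ofPred_eq]
        exact ⟨fun ⟨_, h⟩ => h, fun h => ⟨ha, h⟩⟩
    · intro a
      rfl

lemma monodromy_eta [AlexandrovDiscrete X] (x₀ : X) {x y : SpecPt X} (f : x ⟶ y)
    (m : FreeGroupoid.mk (SpecPt.mk x₀) ⟶ FreeGroupoid.mk x) :
    (pathSpace_covering x₀).monodromy ((etaFunctor X).map f) ⟨⟨x, m⟩, rfl⟩ =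
      ⟨⟨y, m ≫ FreeGroupoid.homMk f⟩, rfl⟩ := by
  set a : PathSpace x₀ := ⟨x, m⟩
  set b : PathSpace x₀ := ⟨y, m ≫ FreeGroupoid.homMk f⟩
  have hab : a ≤ b := ⟨f, rfl⟩
  let γ : Path a b :=
    { toFun := fun t => if t < 1 then a else b
      continuous_toFun := by
        rw [continuous_def]
        intro V hV
        have hs : b ∈ V → a ∈ V := fun h => (pathSpace_isOpen.1 hV) hab h
        by_cases hy : b ∈ V
        · convert isOpen_univ
          ext t
          by_cases ht : t < 1 <;> simp [ht, hy, hs hy]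
        · by_cases hx : a ∈ V
          · convert (isOpen_Iio : IsOpen (Set.Iio (1 : unitInterval)))
            ext t
            by_cases ht : t < 1 <;> simp [ht, hy, hx]
          · convert isOpen_empty
            ext t
            by_cases ht : t < 1 <;> simp [ht, hy, hx]
      source' := by simp
      target' := by simp }
  refine (pathSpace_covering x₀).monodromy_eq_of_map_eq (ex := ⟨a, rfl⟩) (ey := ⟨b, rfl⟩)
    (Path.Homotopic.Quotient.mk γ) ?_
  refine congrArg Path.Homotopic.Quotient.mk ?_
  ext t
  change (if t < 1 then a else b).tgt.pt = if t < 1 then x.pt else y.pt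
  split_ifs <;> rfl

lemma monodromy_loc [AlexandrovDiscrete X] (x₀ : X) {x : SpecPt X}
    (a : FreeGroupoid.mk (SpecPt.mk x₀) ⟶ FreeGroupoid.mk x) :
    ((pathSpace_covering x₀).monodromy ((locToPi X).map a) ⟨⟨⟨x₀⟩, 𝟙 _⟩, rfl⟩).1 =
      ⟨x, a⟩ := by
  let F₁ : FreeGroupoid (SpecPt X) ⥤ Type u :=
    coyoneda.obj (Opposite.op (FreeGroupoid.mk (SpecPt.mk x₀)))
  let F₂ : FreeGroupoid (SpecPt X) ⥤ Type u :=
    locToPi X ⋙ (pathSpace_covering x₀).monodromyFunctor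
  let τ : FreeGroupoid.of (SpecPt X) ⋙ F₁ ⟶ FreeGroupoid.of (SpecPt X) ⋙ F₂ :=
    { app := fun y => ↾(fun m => ⟨⟨y, m⟩, rfl⟩)
      naturality := by
        intro y z f
        ext m
        have := monodromy_eta x₀ f m
        refine Eq.trans ?_ (this.symm.trans ?_)
        · rfl
        · have e : (locToPi X).map (FreeGroupoid.homMk f) = (etaFunctor X).map f :=
            FreeGroupoid.lift_map_homMk _ _
          rw [← e]
          rfl }
  let θ : F₁ ⟶ F₂ := Localization.liftNatTrans (FreeGroupoid.of (SpecPt X)) ⊤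
    (FreeGroupoid.of (SpecPt X) ⋙ F₁) (FreeGroupoid.of (SpecPt X) ⋙ F₂) F₁ F₂ τ
  have hθ : ∀ y, θ.app (FreeGroupoid.mk y) = τ.app y := by
    intro y
    simp [θ]
  have h := types_congr_hom (θ.naturality a) (𝟙 _)
  have h' : (⟨⟨x, 𝟙 _ ≫ a⟩, rfl⟩ : (fun b : PathSpace x₀ => b.tgt.pt) ⁻¹' {x.pt}) =
      (pathSpace_covering x₀).monodromy ((locToPi X).map a) ⟨⟨⟨x₀⟩, 𝟙 _⟩, rfl⟩ := by
    simp only [hθ] at h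
    exact h
  rw [← h']
  simp

lemma locToPi_full [AlexandrovDiscrete X] {x y : SpecPt X} (γ : Path x.pt y.pt) :
    ∃ a : FreeGroupoid.mk x ⟶ FreeGroupoid.mk y,
      (locToPi X).map a = Path.Homotopic.Quotient.mk γ := by
  have small : ∀ {b c : X} (z : X) (δ : Path b c), (∀ t, δ t ⤳ z) →
      ∃ a : FreeGroupoid.mk (SpecPt.mk b) ⟶ FreeGroupoid.mk (SpecPt.mk c),
        (locToPi X).map a = Path.Homotopic.Quotient.mk δ := by
    intro b c z δ hδ
    have hb : SpecPt.mk b ≤ SpecPt.mk z := specPt_le_iff.2 (by simpa using hδ 0)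
    have hc : SpecPt.mk c ≤ SpecPt.mk z := specPt_le_iff.2 (by simpa using hδ 1)
    refine ⟨FreeGroupoid.homMk (homOfLE hb) ≫ Groupoid.inv (FreeGroupoid.homMk (homOfLE hc)), ?_⟩
    have h₁ : (locToPi X).map (FreeGroupoid.homMk (homOfLE hb)) =
      Path.Homotopic.Quotient.mk (eta hb) := FreeGroupoid.lift_map_homMk _ _
    have h₂ : (locToPi X).map (FreeGroupoid.homMk (homOfLE hc)) =
      Path.Homotopic.Quotient.mk (eta hc) := FreeGroupoid.lift_map_homMk _ _
    have h₃ : (locToPi X).map (Groupoid.inv (FreeGroupoid.homMk (homOfLE hc))) =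
        Groupoid.inv ((locToPi X).map (FreeGroupoid.homMk (homOfLE hc))) := by
      simp [Groupoid.inv_eq_inv]
    rw [Functor.map_comp, h₃]
    change Path.Homotopic.Quotient.trans ((locToPi X).map (FreeGroupoid.homMk (homOfLE hb)))
      (Path.Homotopic.Quotient.symm ((locToPi X).map (FreeGroupoid.homMk (homOfLE hc)))) = _
    rw [h₁, h₂]
    refine Quotient.sound (homotopic_of_below z _ _
      (trans_below _ _ (eta_below _ _ specializes_rfl) fun t => ?_) hδ)
    exact eta_below hc _ specializes_rfl _
  obtain ⟨t, t0, tmono, ⟨n, hn⟩, ht⟩ := exists_monotone_Icc_subset_open_cover_unitInterval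
    (c := fun z : X => γ ⁻¹' minOpen z)
    (fun z => (isOpen_sInter fun s hs => hs.1).preimage γ.continuous)
    (fun s _ => Set.mem_iUnion.2 ⟨γ s, mem_minOpen_iff.2 specializes_rfl⟩)
  have main : ∀ k, ∃ a : FreeGroupoid.mk (SpecPt.mk (γ (t 0))) ⟶
      FreeGroupoid.mk (SpecPt.mk (γ (t k))),
        (locToPi X).map a = Path.Homotopic.Quotient.mk (γ.subpath (t 0) (t k)) := by
    intro k
    induction k with
    | zero => exact small (γ (t 0)) _ (fun s => by simp [specializes_rfl])
    | succ k ih =>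
      obtain ⟨a, ha⟩ := ih
      obtain ⟨z, hz⟩ := ht k
      obtain ⟨b, hb⟩ := small z (γ.subpath (t k) (t (k + 1))) (fun s => by
        have : γ.subpath (t k) (t (k + 1)) s ∈ Set.range (γ.subpath (t k) (t (k + 1))) := ⟨s, rfl⟩
        rw [Path.range_subpath_of_le _ _ _ (tmono (Nat.le_succ k))] at this
        obtain ⟨r, hr, hr'⟩ := this
        rw [← hr']
        exact mem_minOpen_iff.1 (hz hr))
      refine ⟨a ≫ b, ?_⟩
      rw [Functor.map_comp, ha, hb]
      exact Quotient.sound ⟨Path.Homotopy.subpathTransSubpath γ _ _ _⟩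
  obtain ⟨a, ha⟩ := main n
  have e₀ : γ (t 0) = x.pt := by rw [t0, γ.source]
  have e₁ : γ (t n) = y.pt := by rw [hn n le_rfl, γ.target]
  refine ⟨eqToHom congr(FreeGroupoid.mk (SpecPt.mk $(e₀.symm))) ≫ a ≫
    eqToHom congr(FreeGroupoid.mk (SpecPt.mk $e₁)), ?_⟩
  rw [Functor.map_comp, Functor.map_comp, ha, eqToHom_map, eqToHom_map]
  refine (FundamentalGroupoid.conj_eqToHom e₀.symm e₁.symm).trans ?_
  refine congrArg Path.Homotopic.Quotient.mk ?_
  ext s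
  simp [Path.subpath, t0, hn n le_rfl]

variable (X) in
/-- The group homomorphism from the automorphism group of `x₀` in the localization of the
preordered set `X` to the fundamental group of the space `X`. -/
def zeta (x₀ : X) : End (FreeGroupoid.mk (SpecPt.mk x₀)) →* FundamentalGroup X x₀ :=
  (locToPi X).mapEnd (FreeGroupoid.mk (SpecPt.mk x₀))

lemma zeta_bijective [AlexandrovDiscrete X] (x₀ : X) : Function.Bijective (zeta X x₀) := by
  constructor
  · intro a b hab
    have ha := monodromy_loc x₀ (x := ⟨x₀⟩) a
    have hb := monodromy_loc x₀ (x := ⟨x₀⟩) b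
    have hab' : (locToPi X).map a = (locToPi X).map b := hab
    rw [hab', hb] at ha
    injection ha with _ h
    exact h.symm
  · rintro ⟨γ⟩
    exact locToPi_full (x := ⟨x₀⟩) (y := ⟨x₀⟩) γ

/-- The canonical isomorphism between the automorphism group of `x₀` in the localization of the
preordered set `X` and the fundamental group of the space `X`. -/
def zetaEquiv [AlexandrovDiscrete X] (x₀ : X) :
    End (FreeGroupoid.mk (SpecPt.mk x₀)) ≃* FundamentalGroup X x₀ :=
  MulEquiv.ofBijective (zeta X x₀) (zeta_bijective x₀)

/-- The homomorphism `F_* : π₁(X, x₀) → G` induced by a functor `F : X → G` to a group: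
the functor `F` induces a functor on localizations, hence a homomorphism from the automorphism
group of `x₀` in the localization of `X`, which is `π₁(X, x₀)`, to the group `G`. -/
def inducedHom [AlexandrovDiscrete X] {G : Type v} [Group G] (F : SpecPt X ⥤ SingleObj G)
    (x₀ : X) : FundamentalGroup X x₀ →* G :=
  (((SingleObj.toEnd G).symm : End (SingleObj.star G) →* G).comp
    ((FreeGroupoid.lift F).mapEnd (FreeGroupoid.mk (SpecPt.mk x₀)))).comp
    ((zetaEquiv x₀).symm : FundamentalGroup X x₀ →* End (FreeGroupoid.mk (SpecPt.mk x₀)))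

end

/-! ### The comma category `F ↓ *` as a space over `X` -/

section

variable {X : Type u} [TopologicalSpace X] {G : Type v} [Group G]

/-- The space `F ↓ *`: the objects of the comma category of `F : X → G` over the unique object
of `G`. It is a thin category, that is, a preordered set, and carries the topology whose open
sets are the lower sets. -/
def Cover (F : SpecPt X ⥤ SingleObj G) : Type (max u v) :=
  CostructuredArrow F (SingleObj.star G)

namespace Cover

variable {F : SpecPt X ⥤ SingleObj G}

instance thin (a b : CostructuredArrow F (SingleObj.star G)) : Subsingleton (a ⟶ b) :=
  ⟨fun f g => CostructuredArrow.hom_ext f g (Subsingleton.elim _ _)⟩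

instance : Preorder (Cover F) where
  le a b := Nonempty (Quiver.Hom (V := CostructuredArrow F (SingleObj.star G)) a b)
  le_refl a := ⟨𝟙 (show CostructuredArrow F (SingleObj.star G) from a)⟩
  le_trans _ _ _ := fun ⟨f⟩ ⟨g⟩ => ⟨f ≫ g⟩

instance : TopologicalSpace (Cover F) := Topology.lowerSet (Cover F)

/-- The object `(x, g)` of `F ↓ *`. -/
def mk (x : X) (g : G) : Cover F :=
  CostructuredArrow.mk (S := F) (T := SingleObj.star G) (Y := SpecPt.mk x) g

/-- The first component of an object of `F ↓ *`. -/
def pt (a : Cover F) : X :=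
  (CostructuredArrow.left a).pt

/-- The second component of an object of `F ↓ *`. -/
def elt (a : Cover F) : G :=
  CostructuredArrow.hom a

variable (F) in
/-- The canonical projection `F ↓ * → X`. -/
def proj [AlexandrovDiscrete X] : C(Cover F, X) where
  toFun := pt
  continuous_toFun := by
    rw [continuous_def]
    intro s hs a b hba ha
    obtain ⟨f⟩ := hba
    exact isOpen_iff_below.1 hs _ _ (leOfHom f.left) ha

end Cover

/-- A covering map is regular if it is surjective and the group of its deck transformations acts
transitively on each fibre. The covering space is not assumed to be connected. -/
def IsRegularCoveringMap {E : Type w} {B : Type u} [TopologicalSpace E] [TopologicalSpace B]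
    (p : E → B) : Prop :=
  IsCoveringMap p ∧ Function.Surjective p ∧
    ∀ a b : E, p a = p b → ∃ φ : E ≃ₜ E, (∀ e, p (φ e) = p e) ∧ φ a = b

end

/-! ### Maximal trees and the functors `F_{T,α}` -/

section

/-- A category is a tree if its localization at all arrows is an indiscrete category. -/
def IsTree (C : Type u) [Category.{v} C] : Prop :=
  ∀ x y : FreeGroupoid C, Nonempty (Unique (x ⟶ y))

/-- A maximal tree of a category: a wide subcategory which is a tree. -/
structure MaximalTree (C : Type u) [Category.{v} C] where
  /-- the arrows of the subcategory -/
  arrows : MorphismProperty C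
  /-- the arrows contain the identities and are closed under composition -/
  mult : arrows.IsMultiplicative
  /-- the wide subcategory is a tree -/
  isTree : IsTree (WideSubcategory arrows)

namespace MaximalTree

variable {C : Type u} [Category.{v} C] (T : MaximalTree C)

attribute [instance] MaximalTree.mult

/-- The image in the localization of `C` of the unique arrow from `x` to `y` in the localization
of the tree. -/
def arrow (x y : C) : FreeGroupoid.mk x ⟶ FreeGroupoid.mk y :=
  (FreeGroupoid.map (wideSubcategoryInclusion T.arrows)).map
    (Classical.choice (T.isTree (FreeGroupoid.mk ⟨x⟩) (FreeGroupoid.mk ⟨y⟩))).default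

lemma arrow_comp (x y z : C) : T.arrow x y ≫ T.arrow y z = T.arrow x z := by
  obtain ⟨h⟩ := T.isTree (FreeGroupoid.mk ⟨x⟩) (FreeGroupoid.mk ⟨z⟩)
  refine ((FreeGroupoid.map (wideSubcategoryInclusion T.arrows)).map_comp _ _).symm.trans ?_
  exact congrArg _ ((h.uniq _).trans (h.uniq _).symm)

lemma arrow_self (x : C) : T.arrow x x = 𝟙 _ := by
  obtain ⟨h⟩ := T.isTree (FreeGroupoid.mk ⟨x⟩) (FreeGroupoid.mk ⟨x⟩)
  refine Eq.trans ?_ ((FreeGroupoid.map (wideSubcategoryInclusion T.arrows)).map_id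
    (FreeGroupoid.mk ⟨x⟩))
  exact congrArg _ ((h.uniq _).trans (h.uniq _).symm)

/-- The functor from `C` to the automorphism group of `c₀` in the localization of `C`
that sends an arrow `f : x ⟶ y` to `β ∘ f ∘ α`, where `α` is the arrow of the tree from `c₀` to
`x` and `β` is the arrow of the tree from `y` to `c₀`. -/
def toAut (c₀ : C) : C ⥤ SingleObj (End (FreeGroupoid.mk c₀)) where
  obj _ := SingleObj.star _
  map {x y} f := End.of (T.arrow c₀ x ≫ (FreeGroupoid.of C).map f ≫ T.arrow y c₀)
  map_id x := by
    change T.arrow c₀ x ≫ (FreeGroupoid.of C).map (𝟙 x) ≫ T.arrow x c₀ = 𝟙 _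
    rw [(FreeGroupoid.of C).map_id, Category.id_comp, arrow_comp, arrow_self]
  map_comp {x y z} f g := by
    have e : T.arrow y c₀ ≫ T.arrow c₀ y = 𝟙 _ := by rw [arrow_comp, arrow_self]
    change T.arrow c₀ x ≫ (FreeGroupoid.of C).map (f ≫ g) ≫ T.arrow z c₀ =
      (T.arrow c₀ x ≫ (FreeGroupoid.of C).map f ≫ T.arrow y c₀) ≫
        (T.arrow c₀ y ≫ (FreeGroupoid.of C).map g ≫ T.arrow z c₀)
    rw [(FreeGroupoid.of C).map_comp]
    simp only [Category.assoc]
    rw [reassoc_of% e]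

end MaximalTree

/-- The functor `F_{T,α} : X → G` associated to a maximal tree `T` of `X` and a homomorphism
`α : π₁(X, x₀) → G`. -/
def treeFunctor {X : Type u} [TopologicalSpace X] [AlexandrovDiscrete X] {G : Type v} [Group G]
    (T : MaximalTree (SpecPt X)) (x₀ : X) (α : FundamentalGroup X x₀ →* G) :
    SpecPt X ⥤ SingleObj G :=
  T.toAut (SpecPt.mk x₀) ⋙ SingleObj.mapHom _ _
    (α.comp (zetaEquiv x₀ : End (FreeGroupoid.mk (SpecPt.mk x₀)) →* FundamentalGroup X x₀))

end

end AlexandroffCovering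

end

open AlexandroffCovering

/-!
The group `G` acts on `F ↓ *` by left multiplication on the second component. The action preserves
the order and is free and transitive on the fibres of the projection, and the open lower set of a
single point is disjoint from its translates, so the projection is the quotient covering map of
this action (`Cover.isQuotientCoveringMap_proj`). In particular the group elements act by deck
transformations, which gives regularity.

Everything else is read off the monodromy. The path `η(x ≤ y)` lifts to the path `η` of
`(x, g) ≤ (y, g F(x ≤ y)⁻¹)`, hence its monodromy multiplies the second component on the right by
`F(x ≤ y)⁻¹`. Arrows of the localization are composites of arrows of `X` and their inverses, so
the same formula holds for all of them (`Cover.monodromy_locToPi`). As `zeta` is onto the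
fundamental group, a loop `γ` at `x₀` moves `(x₀, g)` to `(x₀, g F_*(γ)⁻¹)`
(`Cover.monodromy_inducedHom`). The image of the fundamental group of `F ↓ *` is the stabilizer of
the base point, that is, the kernel of `F_*`. Two points `(x₀, g)` and `(x₀, g')` are joined by a
path if and only if `g⁻¹ g'` is in the image of `F_*`, and by path connectedness of `X` every
point is joined to one of this form.

For a maximal tree `T`, the functor `F_{T,α}` sends an arrow `a` of the localization to the value of
`α` at the loop formed by `a` and two arrows of the tree. For a loop at `x₀` these two arrows are
identities, so `(F_{T,α})_* = α` (`inducedHom_treeFunctor`), and the second half of the theorem is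
the first half for `F_{T,α}`.
-/

/-- A property of arrows of the free groupoid on a category that is stable under composition and
inverses and holds for identities and for the arrows of the category holds for every arrow. -/
lemma CategoryTheory.FreeGroupoid.hom_induction {C : Type u} [Category.{v} C]
    {P : ∀ {x y : C}, (FreeGroupoid.mk x ⟶ FreeGroupoid.mk y) → Prop}
    (id : ∀ x, P (𝟙 (FreeGroupoid.mk x)))
    (comp : ∀ {x y z} (a : FreeGroupoid.mk x ⟶ FreeGroupoid.mk y)
      (b : FreeGroupoid.mk y ⟶ FreeGroupoid.mk z), P a → P b → P (a ≫ b))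
    (inv : ∀ {x y} (a : FreeGroupoid.mk x ⟶ FreeGroupoid.mk y), P a → P (Groupoid.inv a))
    (homMk : ∀ {x y : C} (f : x ⟶ y), P (FreeGroupoid.homMk f))
    {x y : C} (a : FreeGroupoid.mk x ⟶ FreeGroupoid.mk y) : P a := by
  -- an arrow is represented by a path in the symmetrized quiver of the category
  have key : ∀ {y : C} (p : Quiver.Path (V := Quiver.Symmetrify C) x y),
      P (x := x) (y := y) (Quot.mk _ (Quot.mk _ p)) := by
    intro y p
    induction p with
    | nil => exact id x
    | cons p e ih =>
      match e with
      | .inl f => exact comp (Quot.mk _ (Quot.mk _ p)) (FreeGroupoid.homMk f) ih (homMk f)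
      | .inr f =>
        exact comp (Quot.mk _ (Quot.mk _ p)) (Groupoid.inv (FreeGroupoid.homMk f)) ih
          (inv _ (homMk f))
  obtain ⟨⟨p⟩⟩ := a
  exact key p

namespace AlexandroffCovering

/-! ### The functor induced on the localization -/

section

variable {X : Type u} [TopologicalSpace X] {G : Type v} [Group G] (F : SpecPt X ⥤ SingleObj G)

/-- The element of `G` to which the functor induced by `F` on the localization sends an arrow. -/
def locMap {x y : SpecPt X} (a : FreeGroupoid.mk x ⟶ FreeGroupoid.mk y) : G :=
  (FreeGroupoid.lift F).map a

variable {F}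

lemma locMap_id (x : SpecPt X) : locMap F (𝟙 (FreeGroupoid.mk x)) = 1 :=
  (FreeGroupoid.lift F).map_id _

lemma locMap_comp {x y z : SpecPt X} (a : FreeGroupoid.mk x ⟶ FreeGroupoid.mk y)
    (b : FreeGroupoid.mk y ⟶ FreeGroupoid.mk z) :
    locMap F (a ≫ b) = locMap F b * locMap F a :=
  (FreeGroupoid.lift F).map_comp a b

lemma locMap_inv {x y : SpecPt X} (a : FreeGroupoid.mk x ⟶ FreeGroupoid.mk y) :
    locMap F (Groupoid.inv a) = (locMap F a)⁻¹ := by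
  rw [eq_inv_iff_mul_eq_one, ← locMap_comp, Groupoid.comp_inv, locMap_id]

lemma locMap_homMk {x y : SpecPt X} (f : x ⟶ y) :
    locMap F (FreeGroupoid.homMk f) = (F.map f : G) :=
  FreeGroupoid.lift_map_homMk F f

lemma inducedHom_zeta [AlexandrovDiscrete X] (x₀ : X)
    (a : End (FreeGroupoid.mk (SpecPt.mk x₀))) :
    inducedHom F x₀ (zeta X x₀ a) = locMap F a := by
  change locMap F ((zetaEquiv x₀).symm (zetaEquiv x₀ a)) = _
  rw [MulEquiv.symm_apply_apply]

end

/-! ### The covering `F ↓ *` -/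

namespace Cover

variable {X : Type u} [TopologicalSpace X] {G : Type v} [Group G] {F : SpecPt X ⥤ SingleObj G}

lemma le_iff {a b : Cover F} :
    a ≤ b ↔ ∃ f : SpecPt.mk a.pt ⟶ SpecPt.mk b.pt,
      b.elt * locMap F (FreeGroupoid.homMk f) = a.elt := by
  simp_rw [locMap_homMk]
  exact ⟨fun ⟨f⟩ => ⟨f.left, CostructuredArrow.w f⟩, fun ⟨f, hf⟩ => ⟨CostructuredArrow.homMk f hf⟩⟩

lemma isOpen_iff_isLowerSet {s : Set (Cover F)} : IsOpen s ↔ IsLowerSet s := Iff.rfl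

instance : Topology.IsLowerSet (Cover F) := ⟨rfl⟩

/-- The group `G` acts on `F ↓ *` by left multiplication on the second component. -/
instance : MulAction G (Cover F) where
  smul h a := mk a.pt (h * a.elt)
  one_smul a := congrArg (mk (F := F) a.pt) (one_mul a.elt)
  mul_smul h k a := congrArg (mk (F := F) a.pt) (mul_assoc h k a.elt)

lemma smul_le_smul (h : G) {a b : Cover F} (hab : a ≤ b) : h • a ≤ h • b := by
  obtain ⟨f, hf⟩ := le_iff.1 hab
  exact le_iff.2 ⟨f, (mul_assoc _ _ _).trans (congrArg (h * ·) hf)⟩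

lemma proj_eq_iff [AlexandrovDiscrete X] {a b : Cover F} :
    proj F a = proj F b ↔ a ∈ MulAction.orbit G b := by
  constructor
  · intro h
    refine ⟨a.elt * b.elt⁻¹, ?_⟩
    change mk b.pt (a.elt * b.elt⁻¹ * b.elt) = mk a.pt a.elt
    rw [inv_mul_cancel_right, show b.pt = a.pt from h.symm]
  · rintro ⟨h, rfl⟩
    rfl

lemma isOpenQuotientMap_proj [AlexandrovDiscrete X] : IsOpenQuotientMap (proj F) where
  surjective x := ⟨mk x 1, rfl⟩
  continuous := (proj F).continuous
  isOpenMap := by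
    intro s hs
    rw [isOpen_iff_below]
    rintro ⟨x⟩ ⟨_⟩ hxy ⟨b, hb, rfl⟩
    -- the point over `x` below `b` is obtained by moving `b` along the arrow `x ≤ p b`
    exact ⟨mk x (b.elt * locMap F (FreeGroupoid.homMk (homOfLE hxy))),
      isOpen_iff_isLowerSet.1 hs (le_iff.2 ⟨homOfLE hxy, rfl⟩) hb, rfl⟩

variable (F) in
/-- The lower sets of single points are open, and their translates by distinct elements of `G`
are disjoint, because the second component of a point below `e` is determined by its first. -/
lemma isQuotientCoveringMap_proj [AlexandrovDiscrete X] :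
    IsQuotientCoveringMap (proj F) G where
  toIsQuotientMap := isOpenQuotientMap_proj.isQuotientMap
  continuous_const_smul h := by
    rw [continuous_def]
    intro s hs a b hba ha
    exact isOpen_iff_isLowerSet.1 hs (smul_le_smul h hba) ha
  apply_eq_iff_mem_orbit := proj_eq_iff
  disjoint e := by
    refine ⟨Set.Iic e, (isOpen_iff_isLowerSet.2 (isLowerSet_Iic e)).mem_nhds
      (Set.mem_Iic.2 le_rfl), ?_⟩
    rintro h ⟨_, ⟨a, ha, rfl⟩, hb⟩
    obtain ⟨f, hf⟩ := le_iff.1 ha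
    obtain ⟨f', hf'⟩ := le_iff.1 hb
    obtain rfl : f = f' := Subsingleton.elim _ _
    exact mul_eq_right.1 (hf'.symm.trans hf)

lemma isRegularCoveringMap_proj [AlexandrovDiscrete X] : IsRegularCoveringMap (proj F) := by
  have hp := isQuotientCoveringMap_proj F
  have := hp.toContinuousConstSMul
  refine ⟨hp.isCoveringMap, hp.surjective, fun a b hab => ?_⟩
  obtain ⟨h, hh⟩ := proj_eq_iff.1 hab.symm
  exact ⟨Homeomorph.smul h, fun e => rfl, hh⟩

/-! ### Monodromy -/

variable [AlexandrovDiscrete X]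

variable (F) in
lemma isCoveringMap_proj : IsCoveringMap (proj F) :=
  (isQuotientCoveringMap_proj F).isCoveringMap

/-- The point `(x, g)`, as an element of the fibre over `x`. -/
def fiberMk (x : X) (g : G) : proj F ⁻¹' {x} :=
  ⟨mk x g, rfl⟩

lemma fiberMk_injective (x : X) : Function.Injective (fiberMk (F := F) x) := fun _ _ h =>
  congrArg (fun e : proj F ⁻¹' {x} => elt e.1) h

/-- The path `η(a ≤ b)` in `F ↓ *`, where `a = (x, g)` and `b = (y, g F(x ≤ y)⁻¹)`, lifts the path
`η(x ≤ y)`. -/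
lemma monodromy_homMk {x y : SpecPt X} (f : x ⟶ y) (g : G) :
    (isCoveringMap_proj F).monodromy ((locToPi X).map (FreeGroupoid.homMk f))
      (fiberMk x.pt g) = fiberMk y.pt (g * (locMap F (FreeGroupoid.homMk f))⁻¹) := by
  set a : Cover F := mk x.pt g
  set b : Cover F := mk y.pt (g * (locMap F (FreeGroupoid.homMk f))⁻¹)
  have hab : a ≤ b := le_iff.2 ⟨f, inv_mul_cancel_right _ _⟩
  have hab' : SpecPt.mk a ≤ SpecPt.mk b :=
    specPt_le_iff.2 (Topology.IsLowerSet.specializes_iff_le.2 hab)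
  have e : (locToPi X).map (FreeGroupoid.homMk f) = Path.Homotopic.Quotient.mk (eta (leOfHom f)) :=
    FreeGroupoid.lift_map_homMk _ _
  rw [e]
  refine IsCoveringMap.monodromy_eq_of_map_eq _ (ex := ⟨a, rfl⟩) (ey := ⟨b, rfl⟩)
    (Path.Homotopic.Quotient.mk (eta hab')) ?_
  refine congrArg Path.Homotopic.Quotient.mk ?_
  ext t
  change proj F (if t < 1 then a else b) = if t < 1 then x.pt else y.pt
  split_ifs <;> rfl

/-- Monodromy along the image of an arrow `a` of the localization multiplies the second component
on the right by `F(a)⁻¹`. -/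
lemma monodromy_locToPi {x y : SpecPt X} (a : FreeGroupoid.mk x ⟶ FreeGroupoid.mk y) (g : G) :
    (isCoveringMap_proj F).monodromy ((locToPi X).map a) (fiberMk x.pt g) =
      fiberMk y.pt (g * (locMap F a)⁻¹) := by
  have h_comp : ∀ {x y z : SpecPt X} (a : FreeGroupoid.mk x ⟶ FreeGroupoid.mk y)
      (b : FreeGroupoid.mk y ⟶ FreeGroupoid.mk z) (e : proj F ⁻¹' {x.pt}),
      (isCoveringMap_proj F).monodromy ((locToPi X).map (a ≫ b)) e =
        (isCoveringMap_proj F).monodromy ((locToPi X).map b)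
          ((isCoveringMap_proj F).monodromy ((locToPi X).map a) e) := by
    intro x y z a b e
    rw [(locToPi X).map_comp]
    exact (isCoveringMap_proj F).monodromy_trans_apply _ _ e
  have h_id : ∀ (x : SpecPt X) (e : proj F ⁻¹' {x.pt}),
      (isCoveringMap_proj F).monodromy ((locToPi X).map (𝟙 (FreeGroupoid.mk x))) e = e := by
    intro x e
    rw [(locToPi X).map_id]
    exact congrFun (isCoveringMap_proj F).monodromy_refl e
  induction a using FreeGroupoid.hom_induction generalizing g with
  | id x =>
    rw [locMap_id, inv_one, mul_one]
    exact h_id x _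
  | comp a b ha hb =>
    rw [locMap_comp, mul_inv_rev, ← mul_assoc, ← hb, ← ha]
    exact h_comp a b _
  | @inv x y a ha =>
    have h := ha (g * locMap F a)
    rw [mul_inv_cancel_right] at h
    rw [← h, locMap_inv, inv_inv]
    refine (h_comp a (Groupoid.inv a) _).symm.trans ?_
    rw [Groupoid.comp_inv]
    exact h_id x _
  | homMk f => exact monodromy_homMk f g

variable (F) in
lemma monodromy_inducedHom {x : X} (γ : FundamentalGroup X x) (g : G) :
    (isCoveringMap_proj F).monodromy γ (fiberMk x g) =
      fiberMk x (g * (inducedHom F x γ)⁻¹) := by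
  obtain ⟨a, rfl⟩ := (zeta_bijective x).2 γ
  rw [inducedHom_zeta]
  exact monodromy_locToPi a g

/-- A loop lifts to a loop at `e` exactly when its monodromy fixes `e`, that is, when multiplication
by its image under `F_*` is trivial. -/
lemma range_mapOfEq_proj {x₀ : X} {e : Cover F} (he : proj F e = x₀) :
    (FundamentalGroup.mapOfEq (proj F) he).range = (inducedHom F x₀).ker := by
  refine ((isQuotientCoveringMap_proj F).ker_monodromyPerm ⟨e, he⟩).symm.trans ?_
  subst he
  ext γ
  rw [MonoidHom.mem_ker, MonoidHom.mem_ker, DFunLike.ext'_iff]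
  have h := monodromy_inducedHom F γ e.elt
  refine ((isQuotientCoveringMap_proj F).monodromy_eq_id_iff (fiberMk e.pt e.elt)).trans ?_
  refine (Iff.of_eq (congrArg (· = fiberMk e.pt e.elt) h)).trans ?_
  refine (fiberMk_injective (proj F e)).eq_iff.trans ?_
  rw [mul_eq_left, inv_eq_one]

/-! ### Path components -/

lemma joined_mk_iff {x : X} {g g' : G} :
    Joined (mk x g : Cover F) (mk x g') ↔ g⁻¹ * g' ∈ (inducedHom F x).range := by
  constructor
  · rintro ⟨Γ⟩
    let γ : FundamentalGroup X x := Path.Homotopic.Quotient.mk (Γ.map (proj F).continuous)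
    have h : (isCoveringMap_proj F).monodromy γ (fiberMk x g) = fiberMk x g' :=
      (isCoveringMap_proj F).monodromy_map (Path.Homotopic.Quotient.mk Γ)
    replace h := fiberMk_injective x ((monodromy_inducedHom F γ g).symm.trans h)
    exact ⟨γ⁻¹, by rw [← h, map_inv, inv_mul_cancel_left]⟩
  · rintro ⟨γ, hγ⟩
    have h := monodromy_inducedHom F γ⁻¹ g
    rw [map_inv, inv_inv, hγ, mul_inv_cancel_left] at h
    obtain ⟨Γ⟩ := (isCoveringMap_proj F).liftPathQuotient
      (γ⁻¹ : FundamentalGroup X x) (fiberMk x g)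
    exact ⟨Γ.cast rfl congr($(h.symm).1)⟩

/-- Since `X` is path connected, every point of `F ↓ *` can be moved along a lifted path into the
fibre over `x`. -/
lemma exists_joined_mk [ConnectedSpace X] (x : X) (a : Cover F) :
    ∃ g : G, Joined (mk x g) a := by
  have : PathConnectedSpace X := pathConnectedSpace_iff_connectedSpace.2 inferInstance
  let γ : Path a.pt x := PathConnectedSpace.somePath _ _
  obtain ⟨Γ⟩ := (isCoveringMap_proj F).liftPathQuotient (.mk γ) ⟨a, rfl⟩
  generalize (isCoveringMap_proj F).monodromy (.mk γ) ⟨a, rfl⟩ = b at Γ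
  obtain ⟨b, rfl⟩ := b
  exact ⟨b.elt, ⟨Γ.symm⟩⟩

/-- The points `(x₀, g₀ g)` meet every path component, and two of them lie in the same component
exactly when the elements `g` lie in the same left coset of the image of `F_*`. -/
lemma exists_zerothHomotopy_equiv [ConnectedSpace X] {x₀ : X} {e : Cover F}
    (he : proj F e = x₀) :
    ∃ φ : ZerothHomotopy (Cover F) ≃ G ⧸ (inducedHom F x₀).range,
      φ (ZerothHomotopy.mk e) = ((1 : G) : G ⧸ (inducedHom F x₀).range) ∧
      ∀ g : G, φ (ZerothHomotopy.mk (mk x₀ (e.elt * g))) = g := by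
  have h_joined : ∀ g g' : G, ZerothHomotopy.mk (mk x₀ (e.elt * g) : Cover F) =
      ZerothHomotopy.mk (mk x₀ (e.elt * g')) ↔
        (g : G ⧸ (inducedHom F x₀).range) = (g' : G ⧸ (inducedHom F x₀).range) := by
    intro g g'
    refine Quotient.eq.trans (joined_mk_iff.trans ?_)
    rw [QuotientGroup.eq, mul_inv_rev, mul_assoc, inv_mul_cancel_left]
  let ψ : G ⧸ (inducedHom F x₀).range → ZerothHomotopy (Cover F) :=
    Quotient.lift (fun g => ZerothHomotopy.mk (mk x₀ (e.elt * g)))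
      fun g g' h => (h_joined g g').2 (Quotient.sound h)
  have hψ : Function.Bijective ψ := by
    constructor
    · rintro ⟨g⟩ ⟨g'⟩ h
      exact (h_joined g g').1 h
    · intro c
      obtain ⟨a, rfl⟩ := ZerothHomotopy.mk_surjective c
      obtain ⟨g, ⟨Γ⟩⟩ := exists_joined_mk x₀ a
      refine ⟨((e.elt⁻¹ * g : G) : G ⧸ (inducedHom F x₀).range), ?_⟩
      change ZerothHomotopy.mk (mk x₀ (e.elt * (e.elt⁻¹ * g))) = _
      rw [mul_inv_cancel_left]
      exact ZerothHomotopy.sound Γ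
  have h_symm : ∀ g : G, (Equiv.ofBijective ψ hψ).symm
      (ZerothHomotopy.mk (mk x₀ (e.elt * g))) = g := fun g =>
    (Equiv.ofBijective ψ hψ).symm_apply_apply (g : G ⧸ (inducedHom F x₀).range)
  refine ⟨(Equiv.ofBijective ψ hψ).symm, ?_, h_symm⟩
  have h_mk : e = mk x₀ (e.elt * 1) := by
    rw [mul_one, ← he]
    rfl
  exact (congrArg _ (congrArg _ h_mk)).trans (h_symm 1)

end Cover

/-! ### Maximal trees -/

section

variable {X : Type u} [TopologicalSpace X] [AlexandrovDiscrete X] {G : Type v} [Group G]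

/-- The functor `F_{T,α}` sends an arrow of the localization to the value of `α` at the loop
obtained by closing the arrow up with arrows of the tree. -/
lemma locMap_treeFunctor (T : MaximalTree (SpecPt X)) (x₀ : X) (α : FundamentalGroup X x₀ →* G)
    {x y : SpecPt X} (a : FreeGroupoid.mk x ⟶ FreeGroupoid.mk y) :
    locMap (treeFunctor T x₀ α) a =
      α (zeta X x₀ (T.arrow ⟨x₀⟩ x ≫ a ≫ T.arrow y ⟨x₀⟩)) := by
  let c {x y : SpecPt X} (a : FreeGroupoid.mk x ⟶ FreeGroupoid.mk y) :
      End (FreeGroupoid.mk (SpecPt.mk x₀)) :=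
    T.arrow ⟨x₀⟩ x ≫ a ≫ T.arrow y ⟨x₀⟩
  have c_id : ∀ x : SpecPt X, c (𝟙 (FreeGroupoid.mk x)) = 1 := fun x => by
    change T.arrow ⟨x₀⟩ x ≫ 𝟙 (FreeGroupoid.mk x) ≫ T.arrow x ⟨x₀⟩ = 𝟙 _
    rw [Category.id_comp, T.arrow_comp, T.arrow_self]
  have c_comp : ∀ {x y z : SpecPt X} (a : FreeGroupoid.mk x ⟶ FreeGroupoid.mk y)
      (b : FreeGroupoid.mk y ⟶ FreeGroupoid.mk z), c (a ≫ b) = c b * c a := fun {x y z} a b => by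
    have e : T.arrow y ⟨x₀⟩ ≫ T.arrow ⟨x₀⟩ y = 𝟙 _ := by rw [T.arrow_comp, T.arrow_self]
    change T.arrow ⟨x₀⟩ x ≫ (a ≫ b) ≫ T.arrow z ⟨x₀⟩ =
      (T.arrow ⟨x₀⟩ x ≫ a ≫ T.arrow y ⟨x₀⟩) ≫ T.arrow ⟨x₀⟩ y ≫ b ≫ T.arrow z ⟨x₀⟩
    simp only [Category.assoc]
    rw [reassoc_of% e]
  change locMap (treeFunctor T x₀ α) a = α (zeta X x₀ (c a))
  induction a using FreeGroupoid.hom_induction with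
  | id x => rw [locMap_id, c_id, map_one, map_one]
  | comp a b ha hb => rw [locMap_comp, c_comp, map_mul, map_mul, ha, hb]
  | inv a ha =>
    rw [locMap_inv, inv_eq_iff_mul_eq_one, ha, ← map_mul, ← map_mul, ← c_comp, Groupoid.inv_comp,
      c_id, map_one, map_one]
  | homMk f => exact locMap_homMk f

/-- Closing up a loop at `x₀` does not change it, as the arrow of the tree from `x₀` to itself is the
identity. -/
lemma inducedHom_treeFunctor (T : MaximalTree (SpecPt X)) (x₀ : X)
    (α : FundamentalGroup X x₀ →* G) : inducedHom (treeFunctor T x₀ α) x₀ = α := by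
  ext γ
  obtain ⟨a, rfl⟩ := (zeta_bijective x₀).2 γ
  rw [inducedHom_zeta, locMap_treeFunctor]
  rw [T.arrow_self, Category.id_comp, Category.comp_id]

end

end AlexandroffCovering

open AlexandroffCovering
theorem mainTheorem2 {X : Type u} [TopologicalSpace X] [AlexandrovDiscrete X] [ConnectedSpace X]
    (x₀ : X) {G : Type v} [Group G] :
    (∀ (F : SpecPt X ⥤ SingleObj G) (e : Cover F) (he : Cover.proj F e = x₀),
      IsRegularCoveringMap (Cover.proj F) ∧
      (FundamentalGroup.mapOfEq (Cover.proj F) he).range = (inducedHom F x₀).ker ∧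
      ∃ φ : ZerothHomotopy (Cover F) ≃ G ⧸ (inducedHom F x₀).range,
        φ (ZerothHomotopy.mk e) = ((1 : G) : G ⧸ (inducedHom F x₀).range) ∧
        ∀ g : G, φ (ZerothHomotopy.mk (Cover.mk x₀ (e.elt * g))) = g) ∧
    (∀ (T : MaximalTree (SpecPt X)) (α : FundamentalGroup X x₀ →* G)
      (e : Cover (treeFunctor T x₀ α)) (he : Cover.proj (treeFunctor T x₀ α) e = x₀),
      IsRegularCoveringMap (Cover.proj (treeFunctor T x₀ α)) ∧
      (FundamentalGroup.mapOfEq (Cover.proj (treeFunctor T x₀ α)) he).range = α.ker ∧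
      ∃ φ : ZerothHomotopy (Cover (treeFunctor T x₀ α)) ≃ G ⧸ α.range,
        φ (ZerothHomotopy.mk e) = ((1 : G) : G ⧸ α.range) ∧
        ∀ g : G, φ (ZerothHomotopy.mk (Cover.mk x₀ (e.elt * g))) = g) := by
  have main : ∀ (F : SpecPt X ⥤ SingleObj G) (e : Cover F) (he : Cover.proj F e = x₀),
      IsRegularCoveringMap (Cover.proj F) ∧
      (FundamentalGroup.mapOfEq (Cover.proj F) he).range = (inducedHom F x₀).ker ∧
      ∃ φ : ZerothHomotopy (Cover F) ≃ G ⧸ (inducedHom F x₀).range,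
        φ (ZerothHomotopy.mk e) = ((1 : G) : G ⧸ (inducedHom F x₀).range) ∧
        ∀ g : G, φ (ZerothHomotopy.mk (Cover.mk x₀ (e.elt * g))) = g := fun F e he =>
    ⟨Cover.isRegularCoveringMap_proj, Cover.range_mapOfEq_proj he,
      Cover.exists_zerothHomotopy_equiv he⟩
  refine ⟨main, fun T α e he => ?_⟩
  have h := main (treeFunctor T x₀ α) e he
  rw [inducedHom_treeFunctor] at h
  exact h
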